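/- Let $T>0$, let $D[0,T]$ be the set of càdlàg functions $\omega:[0,T]\to\mathbb R$, let $C[0,T]\subset D[0,T]$ be the continuous ones, and put $\Lambda=[0,T]\times D[0,T]$ with the pseudo-metric $$d_\infty\big((t,\omega),(t',\omega')\big)=|t-t'|+\sup_{0\le s\le T}|\omega_{t\wedge s}-\omega'_{t'\wedge s}| .$$ Write $\omega^t=\omega(\cdot\wedge t)$ for the path stopped at $t$. For $f:\Lambda\to\mathbb R$ define, when the limits exist, the horizontal derivative $$\partial_t f(t,\omega)=\lim_{h\to0+}\frac{f(t+h,\omega^t)-f(t,\omega)}{h}\quad(t<T),$$ the vertical derivative $$\partial_\omega f(t,\omega)=\lim_{h\to0}\frac{f(t,\omega+h1_{[t,T]})-f(t,\omega)}{h},$$ and $\partial_{\omega\omega}f=\partial_\omega(\partial_\omega f)$. Say that $f\in C^{1,2}(\Lambda)$ (in the sense of Dupire) if $f$ is $d_\infty$-continuous on $\Lambda$; $\partial_\omega f$ and $\partial_{\omega\omega}f$ exist and are $d_\infty$-continuous on $\Lambda$; and $\partial_tf$ exists on $[0,T)\times D[0,T]$, is continuous at fixed times (for every $t<T$, $\omega\mapsto\partial_tf(t,\omega)$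 is continuous with respect to $\sup_{s\le t}|\omega_s-\omega'_s|$) and is locally bounded with respect to $d_\infty$ (the conditions on $\partial_tf$ hold in particular if $\partial_t f$ exists and is $d_\infty$-continuous). Let $f^1,f^2\in C^{1,2}(\Lambda)$ satisfy $f^1(t,\omega)=f^2(t,\omega)$ for all $(t,\omega)\in[0,T]\times C[0,T]$. Then $$\partial_\omega f^1(t,\omega)=\partial_\omega f^2(t,\omega),\qquad \partial_{\omega\omega}f^1(t,\omega)=\partial_{\omega\omega}f^2(t,\omega)\qquad\text{for all }(t,\omega)\in[0,T]\times C[0,T].$$ -/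

import Mathlib

open Filter Topology Set

noncomputable section

namespace PathCalculus

/-- A function on `[0,T]` is càdlàg (RCLL): right-continuous at every point, with a left limit at
every point (the condition at the left end point is void, since `𝓝[<] 0` is trivial there). -/
def IsCadlag {T : ℝ} (x : Icc (0 : ℝ) T → ℝ) : Prop :=
  ∀ s : Icc (0 : ℝ) T, ContinuousWithinAt x (Ici s) s ∧ ∃ l : ℝ, Tendsto x (𝓝[<] s) (𝓝 l)

/-- The path space `Ω = D([0,T], ℝ)`. -/
structure Path (T : ℝ) where
  /-- the underlying function -/
  val : Icc (0 : ℝ) T → ℝ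
  /-- it is càdlàg -/
  cadlag : IsCadlag val

/-- Functionals `f : [0,T] × D([0,T]) → ℝ`, in curried form. -/
abbrev Functional (T : ℝ) : Type := Icc (0 : ℝ) T → Path T → ℝ

theorem isCadlag_stopped {T : ℝ} (t : Icc (0 : ℝ) T) {x : Icc (0 : ℝ) T → ℝ} (hx : IsCadlag x) :
    IsCadlag (fun s => x (min t s)) := by
  intro s
  have hc : Continuous (fun u : Icc (0 : ℝ) T => min t u) := continuous_const.min continuous_id
  refine ⟨?_, ?_⟩
  · refine ContinuousWithinAt.comp (t := Ici (min t s)) (hx (min t s)).1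
      hc.continuousAt.continuousWithinAt ?_
    intro u hu
    exact min_le_min_left t hu
  · rcases le_or_gt s t with h | h
    · obtain ⟨l, hl⟩ := (hx s).2
      refine ⟨l, hl.congr' ?_⟩
      filter_upwards [self_mem_nhdsWithin] with u hu
      rw [min_eq_right (le_trans (le_of_lt hu) h)]
    · refine ⟨x t, tendsto_const_nhds.congr' ?_⟩
      filter_upwards [nhdsWithin_le_nhds (Ioi_mem_nhds h)] with u hu
      rw [min_eq_left (le_of_lt hu)]

theorem isCadlag_bump {T : ℝ} (t : Icc (0 : ℝ) T) (h : ℝ) {x : Icc (0 : ℝ) T → ℝ}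
    (hx : IsCadlag x) : IsCadlag (fun s => x s + if t ≤ s then h else 0) := by
  intro s
  obtain ⟨l, hl⟩ := (hx s).2
  rcases le_or_gt t s with hs | hs
  · refine ⟨?_, ?_⟩
    · refine (hx s).1.add ((continuousWithinAt_const (b := h)).congr ?_ ?_)
      · intro u hu
        exact if_pos (le_trans hs hu)
      · exact if_pos hs
    · rcases eq_or_lt_of_le hs with hs' | hs'
      · refine ⟨l, hl.congr' ?_⟩
        filter_upwards [self_mem_nhdsWithin] with u hu
        have : ¬ t ≤ u := by
          rw [hs']
          exact not_le.mpr hu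
        simp [this]
      · refine ⟨l + h, (hl.add_const h).congr' ?_⟩
        filter_upwards [nhdsWithin_le_nhds (Ioi_mem_nhds hs')] with u hu
        have : t ≤ u := le_of_lt hu
        simp [this]
  · have key : ∀ᶠ u in 𝓝 s, x u = x u + if t ≤ u then h else 0 := by
      filter_upwards [Iio_mem_nhds hs] with u hu
      have : ¬ t ≤ u := not_le.mpr hu
      simp [this]
    refine ⟨?_, l, hl.congr' (key.filter_mono nhdsWithin_le_nhds)⟩
    exact (hx s).1.congr_of_eventuallyEq
      ((key.filter_mono nhdsWithin_le_nhds).mono fun u hu => hu.symm) key.self_of_nhds.symm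

/-- The stopped path `ω^t = ω(· ∧ t)`. -/
def Path.stopped {T : ℝ} (t : Icc (0 : ℝ) T) (ω : Path T) : Path T :=
  ⟨fun s => ω.val (min t s), isCadlag_stopped t ω.cadlag⟩

/-- The bumped path `ω + h 1_{[t,T]}`. -/
def Path.bump {T : ℝ} (t : Icc (0 : ℝ) T) (h : ℝ) (ω : Path T) : Path T :=
  ⟨fun s => ω.val s + if t ≤ s then h else 0, isCadlag_bump t h ω.cadlag⟩

/-- A càdlàg path on `[0,T]` is bounded; hence the supremum in `dInf` below is a genuine one. -/
theorem Path.exists_bound {T : ℝ} (ω : Path T) : ∃ C : ℝ, ∀ s, |ω.val s| ≤ C := by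
  have loc : ∀ s : Icc (0 : ℝ) T, ∃ C : ℝ, ∀ᶠ u in 𝓝 s, |ω.val u| ≤ C := by
    intro s
    obtain ⟨hr, l, hl⟩ := ω.cadlag s
    have h1 : ∀ᶠ u in 𝓝[≥] s, |ω.val u| < |ω.val s| + 1 :=
      hr.abs.eventually_lt_const (lt_add_one _)
    have h2 : ∀ᶠ u in 𝓝[<] s, |ω.val u| < |l| + 1 :=
      hl.abs.eventually_lt_const (lt_add_one _)
    refine ⟨max (|ω.val s| + 1) (|l| + 1), ?_⟩
    rw [← nhdsLT_sup_nhdsGE s, eventually_sup]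
    exact ⟨h2.mono fun u hu => hu.le.trans (le_max_right _ _),
      h1.mono fun u hu => hu.le.trans (le_max_left _ _)⟩
  choose C hC using loc
  obtain ⟨S, -, hS⟩ := (isCompact_univ (X := Icc (0 : ℝ) T)).elim_nhds_subcover
    (fun s => {u | |ω.val u| ≤ C s}) (fun s _ => hC s)
  obtain ⟨M, hM⟩ := (S.image C).exists_le
  refine ⟨M, fun u => ?_⟩
  obtain ⟨s, hs, hu⟩ := mem_iUnion₂.mp (hS (mem_univ u))
  exact le_trans hu (hM _ (Finset.mem_image_of_mem C hs))

/-- Dupire's pseudo-distance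
`d_∞((t,ω),(t',ω')) = |t - t'| + sup_{0 ≤ s ≤ T} |ω(t ∧ s) - ω'(t' ∧ s)|`. -/
def dInf {T : ℝ} (t : Icc (0 : ℝ) T) (ω : Path T) (t' : Icc (0 : ℝ) T) (ω' : Path T) : ℝ :=
  |(t : ℝ) - (t' : ℝ)| + ⨆ s : Icc (0 : ℝ) T, |ω.val (min t s) - ω'.val (min t' s)|

/-- `f ∈ C(Λ)`: continuity on `Λ = [0,T] × D([0,T])` with respect to `d_∞`. Such a functional is
automatically non-anticipative, because `d_∞((t,ω),(t,ω^t)) = 0`. -/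
def IsContinuous {T : ℝ} (f : Functional T) : Prop :=
  ∀ (t : Icc (0 : ℝ) T) (ω : Path T), ∀ ε > 0, ∃ δ > 0, ∀ (t' : Icc (0 : ℝ) T) (ω' : Path T),
    dInf t ω t' ω' < δ → |f t' ω' - f t ω| < ε

/-- Continuity at fixed times, on `[0,T) × D([0,T])`: for each `t < T` the map `ω ↦ F(t,ω)` is
continuous for `sup_{s ≤ t} |ω_s - ω'_s| = d_∞((t,ω),(t,ω'))`. -/
def IsContinuousAtFixedTimes {T : ℝ} (F : Functional T) : Prop :=
  ∀ t : Icc (0 : ℝ) T, (t : ℝ) < T → ∀ ω : Path T, ∀ ε > 0, ∃ δ > 0, ∀ ω' : Path T,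
    dInf t ω t ω' < δ → |F t ω' - F t ω| < ε

/-- Local boundedness on `[0,T) × D([0,T])` with respect to `d_∞`. -/
def IsLocallyBounded {T : ℝ} (F : Functional T) : Prop :=
  ∀ t : Icc (0 : ℝ) T, (t : ℝ) < T → ∀ ω : Path T, ∃ δ > 0, ∃ C : ℝ,
    ∀ t' : Icc (0 : ℝ) T, (t' : ℝ) < T → ∀ ω' : Path T, dInf t ω t' ω' < δ → |F t' ω'| ≤ C

/-- `a` is the horizontal derivative of `f` at `(t,ω)`, `t < T`:
`a = lim_{h → 0+} (f(t+h, ω^t) - f(t,ω)) / h`, written with `u = t + h`. -/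
def HasHorizontalDeriv {T : ℝ} (f : Functional T) (t : Icc (0 : ℝ) T) (ω : Path T) (a : ℝ) : Prop :=
  Tendsto (fun u : Icc (0 : ℝ) T => (f u (ω.stopped t) - f t ω) / ((u : ℝ) - (t : ℝ))) (𝓝[>] t) (𝓝 a)

/-- `f` is vertically differentiable at `(t,ω)`: the limit of
`(f(t, ω + h 1_{[t,T]}) - f(t,ω)) / h` as `h → 0` exists. -/
def VerticallyDifferentiableAt {T : ℝ} (f : Functional T) (t : Icc (0 : ℝ) T) (ω : Path T) : Prop :=
  DifferentiableAt ℝ (fun h : ℝ => f t (ω.bump t h)) 0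

/-- The vertical derivative `∂_ω f`, again a functional; `∂_{ωω} f` is `vDeriv (vDeriv f)`. -/
def vDeriv {T : ℝ} (f : Functional T) : Functional T :=
  fun t ω => deriv (fun h : ℝ => f t (ω.bump t h)) 0

/-- The class `C^{1,2}(Λ)` in the sense of Dupire: `f` is continuous; it has a horizontal derivative
`∂_t f` on `[0,T) × D([0,T])` which is continuous at fixed times and locally bounded (both hold if
`∂_t f` is continuous for `d_∞`); and it is twice vertically differentiable on `Λ`, with `∂_ω f` and
`∂_{ωω} f` continuous. -/
structure IsC12 {T : ℝ} (f : Functional T) : Prop where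
  continuous : IsContinuous f
  horizontal : ∃ F : Functional T,
    (∀ t : Icc (0 : ℝ) T, (t : ℝ) < T → ∀ ω : Path T, HasHorizontalDeriv f t ω (F t ω)) ∧
      IsContinuousAtFixedTimes F ∧ IsLocallyBounded F
  vertical : ∀ t ω, VerticallyDifferentiableAt f t ω
  vertical_continuous : IsContinuous (vDeriv f)
  vertical_two : ∀ t ω, VerticallyDifferentiableAt (vDeriv f) t ω
  vertical_two_continuous : IsContinuous (vDeriv (vDeriv f))

end PathCalculus

end

open Filter Topology Set

noncomputable section

namespace PathCalculus

/-! By subtraction and symmetry, it is enough to take a C^{1,2} functional `f` vanishing on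
continuous paths and to show that its first two vertical derivatives are nonpositive at continuous
paths. The time `T` is reached from `t < T` by d_∞-continuity (`IsContinuous.nonpos_of_lt`).

Suppose one of these derivatives is positive at (t, ω). It exceeds some c > 0 on a d_∞-ball where
∂_t f is bounded by C. Freeze ω at t and add a jump at each time of a grid of mesh δ = η/2^n.
Between grid times `f` loses at most |C|δ (`stair_flow`), and the jumps are sized so that the
vertical gain exceeds this loss by δ. At time t + η, `f` therefore stays above a positive constant,
uniformly in n. If the staircases are equicontinuous in the limit, they cluster uniformly at a
continuous path, where `f` is zero: a contradiction (`not_eventually_le_stair`).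

For the first derivative all jumps equal Kδ, and the staircases approximate a ramp of slope K.

For the second derivative the jumps are ±ε with ε² = Kδ, and only the average over the two signs
gains. Greedy signs could destroy equicontinuity. Hence the sign is chosen for `f` minus a penalty
that is a martingale under fair signs: averaging leaves the penalty unchanged, so one sign preserves
the inequality f ≥ jδ + penalty. The penalty sums discrete fourth Hermite polynomials of block
displacements over all dyadic scales. It is bounded below by a small constant, so the gain survives.
The local bound f ≤ 1 bounds it above, which yields a modulus of continuity independent of n. This
is a deterministic form of Kolmogorov's criterion (`exists_equicontinuous_walk`). -/

/-! ### Bumped paths and one-variable derivative inequalities -/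

theorem Path.ext_val {T : ℝ} {x y : Path T} (h : ∀ u, x.val u = y.val u) : x = y := by
  cases x
  cases y
  congr
  exact funext h

theorem Path.bump_bump {T : ℝ} (t : Icc (0 : ℝ) T) (a b : ℝ) (ω : Path T) :
    (ω.bump t a).bump t b = ω.bump t (a + b) := by
  refine Path.ext_val fun u => ?_
  simp only [Path.bump]
  split_ifs <;> ring

theorem Path.bump_zero {T : ℝ} (t : Icc (0 : ℝ) T) (ω : Path T) : ω.bump t 0 = ω := by
  refine Path.ext_val fun u => ?_
  simp [Path.bump]

theorem dInf_le {T : ℝ} {t t' : Icc (0 : ℝ) T} {ω ω' : Path T} {a b : ℝ}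
    (h : |(t : ℝ) - (t' : ℝ)| ≤ a) (h' : ∀ s, |ω.val (min t s) - ω'.val (min t' s)| ≤ b) :
    dInf t ω t' ω' ≤ a + b :=
  haveI : Nonempty (Icc (0 : ℝ) T) := ⟨t⟩
  add_le_add h (ciSup_le h')

theorem hasDerivAt_bump {T : ℝ} {f : Functional T} (hf : ∀ t ω, VerticallyDifferentiableAt f t ω)
    (t : Icc (0 : ℝ) T) (ω : Path T) (a : ℝ) :
    HasDerivAt (fun h => f t (ω.bump t h)) (vDeriv f t (ω.bump t a)) a := by
  have h1 : HasDerivAt (fun h => f t ((ω.bump t a).bump t h)) (vDeriv f t (ω.bump t a)) (a - a) := by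
    rw [sub_self]
    exact (hf t (ω.bump t a)).hasDerivAt
  have h2 := h1.comp_sub_const a a
  refine h2.congr_of_eventuallyEq (Eventually.of_forall fun h => ?_)
  simp [Path.bump_bump]

/-- Between times `a ≤ b` along a path frozen at `a`, a functional whose horizontal derivative is at
least `-C` decreases by at most `C (b - a)`. -/
theorem sub_le_of_horizontal {T : ℝ} {f F : Functional T} (hf : IsContinuous f)
    (hF : ∀ t : Icc (0 : ℝ) T, (t : ℝ) < T → ∀ ω : Path T, HasHorizontalDeriv f t ω (F t ω))
    {a b : Icc (0 : ℝ) T} (hab : a ≤ b) {γ : Path T} {C : ℝ}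
    (hγ : ∀ v, a ≤ v → γ.stopped v = γ)
    (hC : ∀ v, a ≤ v → v < b → -C ≤ F v γ) : f a γ - C * (b - a) ≤ f b γ := by
  have h0T : (0 : ℝ) ≤ T := a.2.1.trans a.2.2
  let p : ℝ → Icc (0 : ℝ) T := projIcc 0 T h0T
  have hp : ∀ x ∈ Icc (a : ℝ) b, (p x : ℝ) = x := fun x hx => by
    simp only [p]
    rw [projIcc_of_mem h0T ⟨a.2.1.trans hx.1, hx.2.trans b.2.2⟩]
  have hpa : p a = a := Subtype.ext (hp a ⟨le_rfl, hab⟩)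
  have hpb : p b = b := Subtype.ext (hp b ⟨hab, le_rfl⟩)
  -- Mean value inequality for right derivatives: since γ is frozen from `a` on, the horizontal
  -- difference quotient is the slope of x ↦ f(x, γ).
  have key := image_le_of_deriv_right_le_deriv_boundary (f := fun x => -f (p x) γ)
    (f' := fun x => -F (p x) γ) (a := a) (b := b) (B := fun x => C * (x - a) - f a γ)
    (B' := fun _ => C) ?_ ?_ ?_ ?_ ?_ ?_ (show (b : ℝ) ∈ Icc (a : ℝ) b from ⟨hab, le_rfl⟩)
  · simp only [hpb] at key
    linarith
  · intro x hx
    refine ContinuousWithinAt.neg ?_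
    rw [Metric.continuousWithinAt_iff]
    intro ε hε
    obtain ⟨δ, hδ, h⟩ := hf (p x) γ ε hε
    refine ⟨δ, hδ, fun {y} hy hxy => ?_⟩
    rw [Real.dist_eq]
    refine h _ _ (lt_of_le_of_lt (dInf_le (a := |x - y|) (b := 0) ?_ fun s => ?_) ?_)
    · rw [hp x hx, hp y hy]
    · have h1 := congrArg (fun q : Path T => q.val s)
        (hγ (p x) (by rw [← Subtype.coe_le_coe, hp x hx]; exact hx.1))
      have h2 := congrArg (fun q : Path T => q.val s)
        (hγ (p y) (by rw [← Subtype.coe_le_coe, hp y hy]; exact hy.1))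
      simp only [Path.stopped] at h1 h2
      simp [h1, h2]
    · rw [add_zero, abs_sub_comm]
      exact hxy
  · intro x hx
    have hxI : x ∈ Icc (a : ℝ) b := ⟨hx.1, hx.2.le⟩
    have hxT : (p x : ℝ) < T := by
      rw [hp x hxI]
      exact hx.2.trans_le b.2.2
    have hax : a ≤ p x := by
      rw [← Subtype.coe_le_coe, hp x hxI]
      exact hx.1
    refine HasDerivWithinAt.neg ?_
    rw [← hasDerivWithinAt_Ioi_iff_Ici, hasDerivWithinAt_iff_tendsto_slope' (by simp)]
    have h1 := hF (p x) hxT γ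
    have h2 : Tendsto p (𝓝[>] x) (𝓝[>] (p x)) := by
      refine tendsto_nhdsWithin_iff.mpr
        ⟨(continuous_projIcc.tendsto x).mono_left nhdsWithin_le_nhds, ?_⟩
      filter_upwards [Ioo_mem_nhdsGT hx.2] with y hy
      rw [mem_Ioi, ← Subtype.coe_lt_coe, hp x hxI, hp y ⟨hx.1.trans hy.1.le, hy.2.le⟩]
      exact hy.1
    refine (h1.comp h2).congr' ?_
    filter_upwards [Ioo_mem_nhdsGT hx.2] with y hy
    simp only [Function.comp, hγ _ hax, slope_def_field]
    rw [hp x hxI, hp y ⟨hx.1.trans hy.1.le, hy.2.le⟩]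
  · simp [hpa]
  · fun_prop
  · intro x _
    exact (by simpa using (((hasDerivAt_id x).sub_const (a : ℝ)).const_mul C).sub_const (f a γ) :
      HasDerivAt (fun x => C * (x - a) - f a γ) C x).hasDerivWithinAt
  · intro x hx
    have hxI : x ∈ Icc (a : ℝ) b := ⟨hx.1, hx.2.le⟩
    have := hC (p x) (by rw [← Subtype.coe_le_coe, hp x hxI]; exact hx.1)
      (by rw [← Subtype.coe_lt_coe, hp x hxI]; exact hx.2)
    linarith

theorem add_mul_le_of_deriv_ge {ψ ψ' : ℝ → ℝ} {c ε : ℝ} (hε : 0 ≤ ε)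
    (h1 : ∀ h, HasDerivAt ψ (ψ' h) h) (hc : ∀ h ∈ Icc 0 ε, c ≤ ψ' h) : ψ 0 + c * ε ≤ ψ ε := by
  have := Convex.mul_sub_le_image_sub_of_le_deriv (convex_Icc 0 ε) (f := ψ) (C := c)
    (fun x _ => (h1 x).continuousAt.continuousWithinAt)
    (fun x _ => (h1 x).differentiableAt.differentiableWithinAt)
    (fun x hx => by rw [(h1 x).deriv]; exact hc x (interior_subset hx))
    0 ⟨le_rfl, hε⟩ ε ⟨hε, le_rfl⟩ hε
  linarith

/-- The sum ψ(x) + ψ(-x) has zero derivative at 0 and second derivative at least 2c; integrate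
twice. -/
theorem two_mul_add_le_of_deriv_two_ge {ψ ψ' ψ'' : ℝ → ℝ} {c ε : ℝ} (hε : 0 ≤ ε)
    (h1 : ∀ h, HasDerivAt ψ (ψ' h) h) (h2 : ∀ h, HasDerivAt ψ' (ψ'' h) h)
    (hc : ∀ h ∈ Icc (-ε) ε, c ≤ ψ'' h) : 2 * ψ 0 + c * ε ^ 2 ≤ ψ ε + ψ (-ε) := by
  have e1 : ∀ x, HasDerivAt (fun x => ψ x + ψ (-x)) (ψ' x - ψ' (-x)) x := fun x => by
    have := (h1 x).fun_add ((h1 (-x)).scomp x (hasDerivAt_neg x))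
    simpa [Function.comp_def, sub_eq_add_neg] using this
  have e2 : ∀ x, HasDerivAt (fun x => ψ' x - ψ' (-x)) (ψ'' x + ψ'' (-x)) x := fun x => by
    have := (h2 x).fun_sub ((h2 (-x)).scomp x (hasDerivAt_neg x))
    simpa [Function.comp_def] using this
  have d1 : ∀ x ∈ Icc 0 ε, 2 * c * x ≤ ψ' x - ψ' (-x) := fun x hx => by
    have := add_mul_le_of_deriv_ge (c := 2 * c) hx.1 e2 fun h hh => by
      have a1 := hc h ⟨by linarith [hh.1], hh.2.trans hx.2⟩
      have a2 := hc (-h) ⟨by linarith [hh.2, hx.2], by linarith [hh.1]⟩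
      linarith
    simpa using this
  have := add_mul_le_of_deriv_ge (c := 0) hε (ψ := fun x => ψ x + ψ (-x) - c * x ^ 2)
    (ψ' := fun x => ψ' x - ψ' (-x) - 2 * c * x)
    (fun x => by
      have := (e1 x).fun_sub ((hasDerivAt_pow 2 x).const_mul c)
      exact this.congr_deriv (by norm_num; ring))
    (fun x hx => by linarith [d1 x hx])
  simp at this
  linarith

/-! ### Staircase paths over a grid -/

/-- The time `t + i δ`, projected to `[0,T]`. -/
def gridTime {T : ℝ} (t : Icc (0 : ℝ) T) (δ : ℝ) (i : ℕ) : Icc (0 : ℝ) T :=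
  projIcc 0 T (t.2.1.trans t.2.2) (t + i * δ)

theorem coe_gridTime {T : ℝ} {t : Icc (0 : ℝ) T} {δ : ℝ} (hδ : 0 < δ) {i : ℕ}
    (hi : (t : ℝ) + i * δ ≤ T) : (gridTime t δ i : ℝ) = t + i * δ := by
  unfold gridTime
  rw [projIcc_of_mem _ ⟨add_nonneg t.2.1 (by positivity), hi⟩]

/-- The path `ω` stopped at `t`, with a jump `S (j+1) - S j` added at each grid time `t + j δ`,
`j < i`. -/
def stair {T : ℝ} (t : Icc (0 : ℝ) T) (δ : ℝ) (ω : Path T) (S : ℕ → ℝ) : ℕ → Path T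
  | 0 => ω.stopped t
  | i + 1 => (stair t δ ω S i).bump (gridTime t δ i) (S (i + 1) - S i)

/-- The number of grid times `t + j δ` that are at most `u`. -/
def gridIndex {T : ℝ} (t : Icc (0 : ℝ) T) (δ : ℝ) (u : Icc (0 : ℝ) T) : ℕ :=
  ⌊((u : ℝ) - t) / δ + 1⌋₊

theorem lt_gridIndex_iff {T : ℝ} {t : Icc (0 : ℝ) T} {δ : ℝ} (hδ : 0 < δ) {i : ℕ}
    (hi : (t : ℝ) + i * δ ≤ T) (u : Icc (0 : ℝ) T) :
    i < gridIndex t δ u ↔ gridTime t δ i ≤ u := by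
  rw [← Subtype.coe_le_coe, coe_gridTime hδ hi, ← Nat.succ_le_iff, gridIndex,
    Nat.le_floor_iff' (Nat.succ_ne_zero i)]
  push_cast
  rw [add_le_add_iff_right, le_div_iff₀ hδ]
  constructor <;> intro h <;> linarith

theorem stair_val {T : ℝ} {t : Icc (0 : ℝ) T} {δ : ℝ} (hδ : 0 < δ) (ω : Path T) {S : ℕ → ℝ}
    (hS : S 0 = 0) (u : Icc (0 : ℝ) T) {i : ℕ} (hi : (t : ℝ) + i * δ ≤ T) :
    (stair t δ ω S i).val u = ω.val (min t u) + S (min i (gridIndex t δ u)) := by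
  induction i with
  | zero => simp [stair, Path.stopped, hS]
  | succ i ih =>
    have hi' : (t : ℝ) + i * δ ≤ T := by
      push_cast at hi
      linarith
    have h1 : (stair t δ ω S (i + 1)).val u = (stair t δ ω S i).val u +
      if gridTime t δ i ≤ u then S (i + 1) - S i else 0 := rfl
    rw [h1, ih hi']
    split_ifs with h <;> rw [← lt_gridIndex_iff hδ hi'] at h
    · rw [min_eq_left h.le, min_eq_left (Nat.succ_le_of_lt h)]
      ring
    · rw [min_eq_right (not_lt.mp h), min_eq_right ((not_lt.mp h).trans (Nat.le_succ i))]
      ring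

theorem stair_congr {T : ℝ} {t : Icc (0 : ℝ) T} {δ : ℝ} {ω : Path T} {S S' : ℕ → ℝ} {i : ℕ}
    (h : ∀ j ≤ i, S j = S' j) : stair t δ ω S i = stair t δ ω S' i := by
  induction i with
  | zero => rfl
  | succ i ih =>
    simp only [stair]
    rw [ih fun j hj => h j (hj.trans (Nat.le_succ i)), h (i + 1) le_rfl, h i (Nat.le_succ i)]

theorem gridIndex_mono {T : ℝ} {t : Icc (0 : ℝ) T} {δ : ℝ} (hδ : 0 < δ) {u v : Icc (0 : ℝ) T}
    (h : u ≤ v) : gridIndex t δ u ≤ gridIndex t δ v := by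
  unfold gridIndex
  have : (u : ℝ) ≤ v := h
  gcongr

/-- The last jump of the staircase sits at grid time `i`, not `i + 1`, so the path is already frozen
over the whole cell that follows. -/
theorem stair_succ_stopped {T : ℝ} {t : Icc (0 : ℝ) T} {δ : ℝ} (hδ : 0 < δ) (ω : Path T)
    {S : ℕ → ℝ} (hS : S 0 = 0) {i : ℕ} (hi : (t : ℝ) + (i + 1 : ℕ) * δ ≤ T) {v : Icc (0 : ℝ) T}
    (hv : gridTime t δ i ≤ v) : (stair t δ ω S (i + 1)).stopped v = stair t δ ω S (i + 1) := by
  refine Path.ext_val fun u => ?_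
  have hi' : (t : ℝ) + i * δ ≤ T := by
    push_cast at hi
    linarith
  have htv : t ≤ v := by
    refine le_trans ?_ hv
    rw [← Subtype.coe_le_coe, coe_gridTime hδ hi']
    have : (0 : ℝ) ≤ i * δ := by positivity
    linarith
  simp only [Path.stopped]
  rw [stair_val hδ ω hS _ hi, stair_val hδ ω hS _ hi, ← min_assoc, min_eq_left htv]
  congr 2
  rcases le_total u v with h | h
  · rw [min_eq_right h]
  · have h1 := (lt_gridIndex_iff hδ hi' v).mpr hv
    rw [min_eq_left h, min_eq_left (Nat.succ_le_of_lt h1),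
      min_eq_left (h1.trans_le (gridIndex_mono hδ h))]

theorem dInf_stair_le {T : ℝ} {t : Icc (0 : ℝ) T} {δ : ℝ} (hδ : 0 < δ) (ω : Path T)
    {S : ℕ → ℝ} (hS : S 0 = 0) {i : ℕ} (hi : (t : ℝ) + i * δ ≤ T) {R η : ℝ}
    (hR : ∀ j ≤ i, |S j| ≤ R) {v : Icc (0 : ℝ) T} (hv : t ≤ v) (hη : (v : ℝ) ≤ t + η) :
    dInf t ω v (stair t δ ω S i) ≤ η + R := by
  have hv' : (t : ℝ) ≤ v := hv
  refine dInf_le ?_ fun s => ?_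
  · rw [abs_sub_comm, abs_of_nonneg (by linarith)]
    linarith
  · rw [stair_val hδ ω hS _ hi, ← min_assoc, min_eq_left hv, sub_add_cancel_left, abs_neg]
    exact hR _ (min_le_left _ _)

/-! ### Compactness: continuous limits of staircases -/

theorem IsCadlag.of_continuous {T : ℝ} {x : Icc (0 : ℝ) T → ℝ} (hx : Continuous x) : IsCadlag x :=
  fun s => ⟨hx.continuousWithinAt, x s, hx.continuousAt.tendsto.mono_left nhdsWithin_le_nhds⟩

/-- A bounded, asymptotically equicontinuous sequence of paths has a continuous uniform cluster
point. -/
theorem exists_continuous_cluster {T : ℝ} (γ : ℕ → Path T) (R : ℝ)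
    (hR : ∀ᶠ n in atTop, ∀ u, |(γ n).val u| ≤ R)
    (heq : ∀ ρ > 0, ∃ θ > 0, ∀ᶠ n in atTop, ∀ s u : Icc (0 : ℝ) T, dist s u < θ →
      |(γ n).val s - (γ n).val u| ≤ ρ) :
    ∃ x : Path T, Continuous x.val ∧
      ∀ ρ > 0, ∃ᶠ n in atTop, ∀ u, |x.val u - (γ n).val u| ≤ ρ := by
  -- An ultrafilter gives limits at all times simultaneously, without a diagonal extraction.
  let U : Ultrafilter ℕ := Ultrafilter.of atTop
  have hU : (U : Filter ℕ) ≤ atTop := Ultrafilter.of_le atTop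
  have lim : ∀ u, ∃ l : ℝ, Tendsto (fun n => (γ n).val u) U (𝓝 l) := fun u => by
    obtain ⟨l, -, hl⟩ := (isCompact_Icc (a := -R) (b := R)).ultrafilter_le_nhds
      (U.map fun n => (γ n).val u) (by
        rw [Ultrafilter.coe_map, le_principal_iff, mem_map]
        filter_upwards [hU hR] with n hn
        exact abs_le.mp (hn u))
    exact ⟨l, hl⟩
  choose x hx using lim
  have hxe : ∀ ρ > 0, ∃ θ > 0, ∀ s u : Icc (0 : ℝ) T, dist s u < θ → |x s - x u| ≤ ρ := by
    intro ρ hρ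
    obtain ⟨θ, hθ, h⟩ := heq ρ hρ
    refine ⟨θ, hθ, fun s u hsu => ?_⟩
    refine le_of_tendsto ((hx s).sub (hx u)).abs ?_
    filter_upwards [hU h] with n hn
    exact hn s u hsu
  have hc : Continuous x := by
    rw [Metric.continuous_iff]
    intro u ε hε
    obtain ⟨θ, hθ, h⟩ := hxe (ε / 2) (by positivity)
    refine ⟨θ, hθ, fun s hs => ?_⟩
    rw [Real.dist_eq]
    linarith [h s u hs]
  refine ⟨⟨x, IsCadlag.of_continuous hc⟩, hc, fun ρ hρ => ?_⟩
  suffices h : ∀ᶠ n in (U : Filter ℕ), ∀ u, |x u - (γ n).val u| ≤ ρ from h.frequently.filter_mono hU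
  obtain ⟨θ, hθ, h⟩ := heq (ρ / 3) (by positivity)
  obtain ⟨θ', hθ', h'⟩ := hxe (ρ / 3) (by positivity)
  obtain ⟨A, -, hA⟩ := (isCompact_univ (X := Icc (0 : ℝ) T)).elim_nhds_subcover
    (fun s => Metric.ball s (min θ θ')) (fun s _ => Metric.ball_mem_nhds s (lt_min hθ hθ'))
  have hfin : ∀ᶠ n in (U : Filter ℕ), ∀ a ∈ A, |x a - (γ n).val a| ≤ ρ / 3 := by
    rw [Filter.eventually_all_finset]
    intro a _
    have := ((tendsto_const_nhds (x := x a)).sub (hx a)).abs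
    rw [sub_self, abs_zero] at this
    exact this.eventually_le_const (by positivity)
  filter_upwards [hfin, hU h] with n h1 h2 u
  obtain ⟨a, ha, hu⟩ := mem_iUnion₂.mp (hA (mem_univ u))
  have e1 := h' u a (lt_of_lt_of_le hu (min_le_right _ _))
  have e2 := h2 a u (by rw [dist_comm]; exact lt_of_lt_of_le hu (min_le_left _ _))
  have e3 := h1 a ha
  rw [abs_le] at *
  constructor <;> linarith [e1.1, e1.2, e2.1, e2.2, e3.1, e3.2]

theorem gridIndex_le_add {T : ℝ} {t : Icc (0 : ℝ) T} {δ : ℝ} (hδ : 0 < δ) {u v : Icc (0 : ℝ) T} :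
    (gridIndex t δ v : ℝ) ≤ gridIndex t δ u + (dist v u / δ + 1) := by
  have h1 : ((v : ℝ) - t) / δ + 1 ≤ ((u : ℝ) - t) / δ + 1 + dist v u / δ := by
    have : (v : ℝ) - u ≤ dist v u := by
      rw [Subtype.dist_eq, Real.dist_eq]
      exact le_abs_self _
    rw [add_right_comm, ← add_div]
    gcongr
    linarith
  have h2 := Nat.lt_floor_add_one (((u : ℝ) - t) / δ + 1)
  unfold gridIndex
  rcases le_total 0 (((v : ℝ) - t) / δ + 1) with h | h
  · linarith [Nat.floor_le h]
  · rw [Nat.floor_of_nonpos h]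
    have : 0 ≤ dist v u / δ := by positivity
    push_cast
    positivity

/-- A continuous functional that vanishes on continuous paths cannot stay away from `0` along
staircases that are bounded and equicontinuous in the limit of infinitely fine grids. -/
theorem not_eventually_le_stair {T : ℝ} {f : Functional T} (hf : IsContinuous f)
    (h0 : ∀ t (ω : Path T), Continuous ω.val → f t ω = 0) {t : Icc (0 : ℝ) T} {ω : Path T}
    (hω : Continuous ω.val) {η : ℝ} (hη : 0 < η) (hT : (t : ℝ) + η ≤ T) (S : ℕ → ℕ → ℝ) {R e : ℝ}
    (he : 0 < e) (hS : ∀ᶠ n in atTop, S n 0 = 0)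
    (hR : ∀ᶠ n in atTop, ∀ i ≤ 2 ^ n, |S n i| ≤ R)
    (heq : ∀ ρ > 0, ∃ θ > 0, ∀ᶠ n in atTop, ∀ i j : ℕ, j ≤ 2 ^ n → i ≤ j →
      (j : ℝ) ≤ i + θ * 2 ^ n → |S n j - S n i| ≤ ρ) :
    ¬ ∀ᶠ n in atTop, e ≤ f (gridTime t (η / 2 ^ n) (2 ^ n))
      (stair t (η / 2 ^ n) ω (S n) (2 ^ n)) := by
  intro hcon
  have hδ : ∀ n : ℕ, 0 < η / 2 ^ n := fun n => by positivity
  have hN : ∀ n : ℕ, (t : ℝ) + (2 ^ n : ℕ) * (η / 2 ^ n) = t + η := fun n => by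
    push_cast
    field_simp
  have hval : ∀ n, S n 0 = 0 → ∀ u, (stair t (η / 2 ^ n) ω (S n) (2 ^ n)).val u =
      ω.val (min t u) + S n (min (2 ^ n) (gridIndex t (η / 2 ^ n) u)) := fun n hn u =>
    stair_val (hδ n) ω hn u (by rw [hN]; exact hT)
  have hend : ∀ n, gridTime t (η / 2 ^ n) (2 ^ n) = ⟨t + η, by linarith [t.2.1], hT⟩ := fun n =>
    Subtype.ext (by rw [coe_gridTime (hδ n) (by rw [hN]; exact hT), hN])
  obtain ⟨B, hB⟩ := ω.exists_bound
  obtain ⟨x, hxc, hx⟩ := exists_continuous_cluster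
    (fun n => stair t (η / 2 ^ n) ω (S n) (2 ^ n)) (B + R) (by
      filter_upwards [hS, hR] with n h1 h2 u
      rw [hval n h1]
      exact (abs_add_le _ _).trans (add_le_add (hB _) (h2 _ (min_le_left _ _)))) (by
      intro ρ hρ
      have hωu : UniformContinuous ω.val := CompactSpace.uniformContinuous_of_continuous hω
      obtain ⟨θ, hθ, h1⟩ := Metric.uniformContinuous_iff.mp hωu (ρ / 2) (by positivity)
      obtain ⟨θ', hθ', h2⟩ := heq (ρ / 2) (by positivity)
      have hpow : ∀ᶠ n : ℕ in atTop, 2 / θ' ≤ (2 : ℝ) ^ n :=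
        (tendsto_pow_atTop_atTop_of_one_lt one_lt_two).eventually_ge_atTop _
      -- Half of θ' pays for the distance between the times, half for the rounding error of one cell
      -- in `gridIndex_le_add`, which `hpow` makes negligible.
      refine ⟨min θ (θ' * η / 2), lt_min hθ (by positivity), ?_⟩
      filter_upwards [hS, h2, hpow] with n h0n h2n hn s u hsu
      rw [hval n h0n, hval n h0n]
      have a1 : |ω.val (min t s) - ω.val (min t u)| < ρ / 2 := by
        rw [← Real.dist_eq]
        refine h1 (lt_of_le_of_lt ?_ (lt_of_lt_of_le hsu (min_le_left _ _)))
        rw [Subtype.dist_eq, Subtype.dist_eq, Real.dist_eq, Real.dist_eq]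
        have := abs_min_sub_min_le_max (t : ℝ) s t u
        simpa using this
      have main : ∀ a b : Icc (0 : ℝ) T, a ≤ b → dist b a < θ' * η / 2 →
          |S n (min (2 ^ n) (gridIndex t (η / 2 ^ n) b)) -
            S n (min (2 ^ n) (gridIndex t (η / 2 ^ n) a))| ≤ ρ / 2 := by
        intro a b hab hd
        have hm := gridIndex_mono (t := t) (hδ n) hab
        refine h2n _ _ (min_le_left _ _) (min_le_min le_rfl hm) ?_
        have g1 := gridIndex_le_add (t := t) (hδ n) (u := a) (v := b)
        have g2 : dist b a / (η / 2 ^ n) + 1 ≤ θ' * 2 ^ n := by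
          have : dist b a / (η / 2 ^ n) ≤ θ' / 2 * 2 ^ n := by
            rw [div_le_iff₀ (hδ n)]
            calc dist b a ≤ θ' * η / 2 := hd.le
              _ = _ := by field_simp
          rw [div_le_iff₀ hθ'] at hn
          linarith
        rcases le_total (2 ^ n) (gridIndex t (η / 2 ^ n) a) with h | h
        · rw [min_eq_left h, min_eq_left (h.trans hm)]
          have : 0 < θ' * 2 ^ n := by positivity
          linarith
        · rw [min_eq_right h]
          have : ((min (2 ^ n) (gridIndex t (η / 2 ^ n) b) : ℕ) : ℝ) ≤
            gridIndex t (η / 2 ^ n) b := by exact_mod_cast min_le_right _ _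
          linarith
      have a2 : |S n (min (2 ^ n) (gridIndex t (η / 2 ^ n) s)) -
            S n (min (2 ^ n) (gridIndex t (η / 2 ^ n) u))| ≤ ρ / 2 := by
        have hd := lt_of_lt_of_le hsu (min_le_right _ _)
        rcases le_total s u with h | h
        · rw [abs_sub_comm]
          exact main s u h (by rw [dist_comm]; exact hd)
        · exact main u s h hd
      rw [add_sub_add_comm]
      refine (abs_add_le _ _).trans ?_
      linarith)
  obtain ⟨δ, hδ', hc⟩ := hf ⟨t + η, by linarith [t.2.1], hT⟩ x e he
  obtain ⟨n, hn1, hn2⟩ := ((hx (δ / 2) (by positivity)).and_eventually hcon).exists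
  rw [hend] at hn2
  have := hc ⟨t + η, by linarith [t.2.1], hT⟩ (stair t (η / 2 ^ n) ω (S n) (2 ^ n))
    (lt_of_le_of_lt (dInf_le (a := 0) (b := δ / 2) (by simp) fun s => hn1 _) (by linarith))
  rw [h0 _ x hxc, sub_zero] at this
  linarith [le_abs_self (f ⟨t + η, by linarith [t.2.1], hT⟩ (stair t (η / 2 ^ n) ω (S n) (2 ^ n)))]

/-! ### Quartic martingales and the multiscale penalty -/

/-- The fourth Hermite polynomial of a walk with steps of square `e`, at quadratic variation `v` and
displacement `d`. -/
def quartic (e v d : ℝ) : ℝ := d ^ 4 - 6 * v * d ^ 2 + 3 * v ^ 2 + 2 * v * e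

/-- The martingale property under a fair step ±ε; the term 2ve corrects the continuous-time Hermite
polynomial for the discrete step. -/
theorem quartic_add (ε v d : ℝ) :
    quartic (ε ^ 2) (v + ε ^ 2) (d + ε) + quartic (ε ^ 2) (v + ε ^ 2) (d - ε) =
      2 * quartic (ε ^ 2) v d := by
  unfold quartic
  ring

theorem sq_le_quartic {e v : ℝ} (he : 0 ≤ e) (hv : 0 ≤ v) (d : ℝ) :
    (d ^ 2 - 3 * v) ^ 2 ≤ quartic e v d + 6 * v ^ 2 := by
  unfold quartic
  nlinarith [mul_nonneg hv he]

/-- The value at step `j` of the martingale obtained by summing `quartic` over consecutive blocks of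
length `L`. -/
def blockSum (ε : ℝ) (L : ℕ) (S : ℕ → ℝ) (j : ℕ) : ℝ :=
  ∑ i ∈ Finset.range j,
    (quartic (ε ^ 2) ((i % L : ℕ) * ε ^ 2 + ε ^ 2) (S (i + 1) - S (L * (i / L))) -
      quartic (ε ^ 2) ((i % L : ℕ) * ε ^ 2) (S i - S (L * (i / L))))

theorem blockSum_congr {ε : ℝ} {L : ℕ} {S S' : ℕ → ℝ} {j : ℕ} (h : ∀ k ≤ j, S k = S' k) :
    blockSum ε L S j = blockSum ε L S' j := by
  refine Finset.sum_congr rfl fun i hi => ?_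
  have hi' : i < j := Finset.mem_range.mp hi
  rw [h (i + 1) hi', h i hi'.le, h _ ((Nat.mul_div_le i L).trans hi'.le)]

/-- The block is indexed by the old step `i`, so its starting value is untouched by the update and
`quartic_add` applies to the single new summand. -/
theorem blockSum_update_add {ε : ℝ} {L : ℕ} (S : ℕ → ℝ) (i : ℕ) :
    blockSum ε L (Function.update S (i + 1) (S i + ε)) (i + 1) +
      blockSum ε L (Function.update S (i + 1) (S i - ε)) (i + 1) = 2 * blockSum ε L S i := by
  have h : ∀ x, blockSum ε L (Function.update S (i + 1) x) (i + 1) = blockSum ε L S i +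
      (quartic (ε ^ 2) ((i % L : ℕ) * ε ^ 2 + ε ^ 2) (x - S (L * (i / L))) -
        quartic (ε ^ 2) ((i % L : ℕ) * ε ^ 2) (S i - S (L * (i / L)))) := by
    intro x
    have hk : ∀ k ≤ i, Function.update S (i + 1) x k = S k := fun k hk =>
      Function.update_of_ne (by omega) _ _
    rw [← blockSum_congr hk]
    unfold blockSum
    rw [Finset.sum_range_succ, Function.update_self, hk i le_rfl, hk _ (Nat.mul_div_le i L)]
  have := quartic_add ε ((i % L : ℕ) * ε ^ 2) (S i - S (L * (i / L)))
  rw [h, h, add_sub_right_comm (S i), sub_right_comm (S i) ε]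
  linarith

/-- The increments telescope inside each block. By `sq_le_quartic` a completed block contributes at
least -6(Lε²)², and a new block starts from the value 0. -/
theorem quartic_le_blockSum {ε : ℝ} {L : ℕ} (hL : 0 < L) (S : ℕ → ℝ) (i : ℕ) :
    quartic (ε ^ 2) ((i % L : ℕ) * ε ^ 2) (S i - S (L * (i / L))) -
      6 * (L * ε ^ 2) ^ 2 * (i / L : ℕ) ≤ blockSum ε L S i := by
  induction i with
  | zero => simp [blockSum, quartic]
  | succ i ih =>
    have h1 : blockSum ε L S (i + 1) = blockSum ε L S i +
      (quartic (ε ^ 2) ((i % L : ℕ) * ε ^ 2 + ε ^ 2) (S (i + 1) - S (L * (i / L))) -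
        quartic (ε ^ 2) ((i % L : ℕ) * ε ^ 2) (S i - S (L * (i / L)))) :=
      Finset.sum_range_succ _ _
    have hi : i % L + L * (i / L) = i := Nat.mod_add_div i L
    rcases (Nat.succ_le_of_lt (Nat.mod_lt i hL)).lt_or_eq with h | h
    · obtain ⟨e1, e2⟩ := (Nat.div_mod_unique hL (a := i + 1) (d := i / L) (c := i % L + 1)).mpr
        ⟨by omega, h⟩
      rw [h1, e1, e2]
      push_cast
      rw [add_one_mul]
      linarith
    · have h' : i % L + 1 = L := h
      obtain ⟨e1, e2⟩ := (Nat.div_mod_unique hL (a := i + 1) (d := i / L + 1) (c := 0)).mpr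
        ⟨by rw [mul_add]; omega, hL⟩
      have e3 : L * (i / L + 1) = i + 1 := by
        rw [mul_add]
        omega
      have e4 : ((i % L : ℕ) : ℝ) * ε ^ 2 + ε ^ 2 = L * ε ^ 2 := by
        rw [← add_one_mul]
        congr 1
        exact_mod_cast h'
      have e5 := sq_le_quartic (sq_nonneg ε) (v := L * ε ^ 2) (by positivity)
        (S (i + 1) - S (L * (i / L)))
      have e6 : quartic (ε ^ 2) ((0 : ℕ) * ε ^ 2) (S (i + 1) - S (i + 1)) = 0 := by
        simp [quartic]
      rw [h1, e1, e2, e3, e4, e6]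
      push_cast
      nlinarith [sq_nonneg ((S (i + 1) - S (L * (i / L))) ^ 2 - 3 * (L * ε ^ 2))]

/-- The displacement within the current block is controlled by `blockSum`. -/
theorem sq_le_blockSum {ε : ℝ} {n m : ℕ} (hm : m ≤ n) (S : ℕ → ℝ) {i : ℕ} (hi : i < 2 ^ n) :
    ∃ v ≤ 2 ^ n * ε ^ 2 / 2 ^ m,
      ((S (i + 1) - S (2 ^ (n - m) * (i / 2 ^ (n - m)))) ^ 2 - 3 * v) ^ 2 -
        6 * (2 ^ n * ε ^ 2) ^ 2 / 2 ^ m ≤ blockSum ε (2 ^ (n - m)) S (i + 1) := by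
  set L : ℕ := 2 ^ (n - m) with hLdef
  have hL : 0 < L := by positivity
  have hLm : L * 2 ^ m = 2 ^ n := by
    rw [hLdef, ← pow_add]
    congr 1
    omega
  have hLV : (2 : ℝ) ^ n * ε ^ 2 / 2 ^ m = L * ε ^ 2 := by
    have : (L : ℝ) * 2 ^ m = 2 ^ n := by exact_mod_cast hLm
    rw [← this]
    field_simp
  have hv0 : (0 : ℝ) ≤ (i % L : ℕ) * ε ^ 2 + ε ^ 2 := by positivity
  have hvL : ((i % L : ℕ) : ℝ) * ε ^ 2 + ε ^ 2 ≤ L * ε ^ 2 := by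
    rw [← add_one_mul]
    have : ((i % L : ℕ) : ℝ) + 1 ≤ L := by exact_mod_cast Nat.succ_le_of_lt (Nat.mod_lt i hL)
    gcongr
  refine ⟨(i % L : ℕ) * ε ^ 2 + ε ^ 2, by rw [hLV]; exact hvL, ?_⟩
  have h1 : blockSum ε L S (i + 1) = blockSum ε L S i +
    (quartic (ε ^ 2) ((i % L : ℕ) * ε ^ 2 + ε ^ 2) (S (i + 1) - S (L * (i / L))) -
      quartic (ε ^ 2) ((i % L : ℕ) * ε ^ 2) (S i - S (L * (i / L)))) := Finset.sum_range_succ _ _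
  have h2 := quartic_le_blockSum (ε := ε) hL S i
  have h3 := sq_le_quartic (sq_nonneg ε) hv0 (S (i + 1) - S (L * (i / L)))
  have h4 : ((i / L : ℕ) : ℝ) + 1 ≤ 2 ^ m := by
    have : i / L < 2 ^ m := by
      rw [Nat.div_lt_iff_lt_mul hL, mul_comm, hLm]
      exact hi
    exact_mod_cast this
  have h5 : 6 * (2 ^ n * ε ^ 2) ^ 2 / 2 ^ m = 6 * (L * ε ^ 2) ^ 2 * 2 ^ m := by
    rw [← hLV]
    field_simp
  have h6 : ((i % L : ℕ) * ε ^ 2 + ε ^ 2) ^ 2 ≤ (L * ε ^ 2) ^ 2 := by gcongr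
  have h7 : (L * ε ^ 2) ^ 2 * (((i / L : ℕ) : ℝ) + 1) ≤ (L * ε ^ 2) ^ 2 * 2 ^ m := by gcongr
  rw [h1, h5]
  nlinarith

/-- The weighted sum of `blockSum` over all dyadic block lengths. -/
def multiscale (κ ε : ℝ) (n : ℕ) (S : ℕ → ℝ) (j : ℕ) : ℝ :=
  ∑ m ∈ Finset.range (n + 1), κ * (3 / 2) ^ m * blockSum ε (2 ^ (n - m)) S j

/-- The modulus enforced by a bound on `multiscale`. -/
def modulus (κ V : ℝ) (m : ℕ) : ℝ :=
  3 * (V / 2 ^ m) + √((1 / κ + 24 * V ^ 2) / (3 / 2) ^ m)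

theorem multiscale_congr {κ ε : ℝ} {n : ℕ} {S S' : ℕ → ℝ} {j : ℕ} (h : ∀ k ≤ j, S k = S' k) :
    multiscale κ ε n S j = multiscale κ ε n S' j := by
  unfold multiscale
  simp only [blockSum_congr h]

theorem multiscale_update_add {κ ε : ℝ} {n : ℕ} (S : ℕ → ℝ) (i : ℕ) :
    multiscale κ ε n (Function.update S (i + 1) (S i + ε)) (i + 1) +
      multiscale κ ε n (Function.update S (i + 1) (S i - ε)) (i + 1) =
        2 * multiscale κ ε n S i := by
  unfold multiscale
  rw [← Finset.sum_add_distrib, Finset.mul_sum]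
  refine Finset.sum_congr rfl fun m _ => ?_
  rw [← mul_add, blockSum_update_add]
  ring

theorem sum_three_quarters_le (n : ℕ) : ∑ m ∈ Finset.range n, (3 / 4 : ℝ) ^ m ≤ 4 := by
  have := geom_sum_eq (show (3 / 4 : ℝ) ≠ 1 by norm_num) n
  rw [this, div_le_iff_of_neg (by norm_num)]
  have : (0 : ℝ) < (3 / 4) ^ n := by positivity
  linarith

/-- With V = 2^n ε², scale m has 2^m blocks of variance V/2^m, hence a loss of at most 6V²/2^m. The
weight (3/2)^m keeps the losses summable, yet grows, which makes `modulus` tend to 0. -/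
theorem weight_mul_blockSum_ge {κ ε : ℝ} (hκ : 0 < κ) {n m : ℕ} (hm : m ≤ n) (S : ℕ → ℝ) {i : ℕ}
    (hi : i < 2 ^ n) : -(6 * κ * (2 ^ n * ε ^ 2) ^ 2) * (3 / 4) ^ m ≤
      κ * (3 / 2) ^ m * blockSum ε (2 ^ (n - m)) S (i + 1) := by
  obtain ⟨v, -, hv⟩ := sq_le_blockSum (ε := ε) hm S hi
  have h : -(6 * (2 ^ n * ε ^ 2) ^ 2 / 2 ^ m) ≤ blockSum ε (2 ^ (n - m)) S (i + 1) := by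
    refine le_trans ?_ hv
    linarith [sq_nonneg ((S (i + 1) - S (2 ^ (n - m) * (i / 2 ^ (n - m)))) ^ 2 - 3 * v)]
  calc -(6 * κ * (2 ^ n * ε ^ 2) ^ 2) * (3 / 4) ^ m
      = κ * (3 / 2) ^ m * -(6 * (2 ^ n * ε ^ 2) ^ 2 / 2 ^ m) := by
        rw [show (3 / 4 : ℝ) = 3 / 2 / 2 by norm_num, div_pow (3 / 2 : ℝ) 2 m]
        ring
    _ ≤ _ := by gcongr

theorem multiscale_ge {κ ε : ℝ} (hκ : 0 < κ) {n : ℕ} (S : ℕ → ℝ) {i : ℕ} (hi : i < 2 ^ n) :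
    -(24 * κ * (2 ^ n * ε ^ 2) ^ 2) ≤ multiscale κ ε n S (i + 1) := by
  have h1 : ∑ m ∈ Finset.range (n + 1), -(6 * κ * (2 ^ n * ε ^ 2) ^ 2) * (3 / 4) ^ m ≤
      multiscale κ ε n S (i + 1) :=
    Finset.sum_le_sum fun m hm =>
      weight_mul_blockSum_ge hκ (Nat.lt_succ_iff.mp (Finset.mem_range.mp hm)) S hi
  rw [← Finset.mul_sum] at h1
  have h2 := sum_three_quarters_le (n + 1)
  have h3 : 0 ≤ 6 * κ * (2 ^ n * ε ^ 2) ^ 2 := by positivity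
  nlinarith

/-- Keep the square only at scale m and bound the rest below by -24κV²; the total being at most 1
then controls that square. -/
theorem sq_le_modulus {κ ε : ℝ} (hκ : 0 < κ) {n m : ℕ} (hm : m ≤ n) (S : ℕ → ℝ) {i : ℕ}
    (hi : i < 2 ^ n) (h : multiscale κ ε n S (i + 1) ≤ 1) :
    (S (i + 1) - S (2 ^ (n - m) * (i / 2 ^ (n - m)))) ^ 2 ≤ modulus κ (2 ^ n * ε ^ 2) m := by
  set V : ℝ := 2 ^ n * ε ^ 2 with hV
  set d : ℝ := S (i + 1) - S (2 ^ (n - m) * (i / 2 ^ (n - m))) with hd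
  obtain ⟨v, hvV, hv⟩ := sq_le_blockSum (ε := ε) hm S hi
  rw [← hV] at hvV
  rw [← hV, ← hd] at hv
  have hmem : m ∈ Finset.range (n + 1) := Finset.mem_range.mpr (Nat.lt_succ_of_le hm)
  have hsum : κ * (3 / 2) ^ m * (d ^ 2 - 3 * v) ^ 2 - 24 * κ * V ^ 2 ≤ 1 := by
    refine le_trans ?_ h
    have h1 : ∀ k ∈ Finset.range (n + 1), (-(6 * κ * V ^ 2) * (3 / 4) ^ k +
        if k = m then κ * (3 / 2) ^ m * (d ^ 2 - 3 * v) ^ 2 else 0) ≤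
          κ * (3 / 2) ^ k * blockSum ε (2 ^ (n - k)) S (i + 1) := by
      intro k hk
      split_ifs with hkm
      · subst hkm
        calc _ = κ * (3 / 2) ^ k * ((d ^ 2 - 3 * v) ^ 2 - 6 * V ^ 2 / 2 ^ k) := by
              rw [show (3 / 4 : ℝ) = 3 / 2 / 2 by norm_num, div_pow (3 / 2 : ℝ) 2 k]
              ring
          _ ≤ _ := by gcongr
      · rw [add_zero]
        exact weight_mul_blockSum_ge hκ (Nat.lt_succ_iff.mp (Finset.mem_range.mp hk)) S hi
    have h2 := Finset.sum_le_sum h1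
    rw [Finset.sum_add_distrib, ← Finset.mul_sum, Finset.sum_ite_eq' _ m, if_pos hmem] at h2
    have h3 := sum_three_quarters_le (n + 1)
    have h4 : 0 ≤ 6 * κ * V ^ 2 := by positivity
    refine le_trans ?_ h2
    nlinarith
  have hsq : (d ^ 2 - 3 * v) ^ 2 ≤ (1 / κ + 24 * V ^ 2) / (3 / 2) ^ m := by
    rw [le_div_iff₀ (by positivity)]
    have : κ * ((d ^ 2 - 3 * v) ^ 2 * (3 / 2) ^ m) ≤ κ * (1 / κ + 24 * V ^ 2) := by
      rw [mul_add, mul_one_div_cancel hκ.ne']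
      linarith
    exact le_of_mul_le_mul_left this hκ
  have := (le_abs_self _).trans (Real.abs_le_sqrt hsq)
  unfold modulus
  linarith

/-! ### Choice of the signs -/

/-- If a functional of walks with steps `±ε` gains at least `δ` per step on average over the two
signs, then some walk keeps a gain of half that size while obeying `modulus`. -/
theorem exists_equicontinuous_walk {G : ℕ → (ℕ → ℝ) → ℝ} {κ ε δ R : ℝ} {n : ℕ} (hκ : 0 < κ)
    (hε : 0 ≤ ε) (hδ : 0 ≤ δ)
    (hG : ∀ i S S', (∀ j ≤ i, S j = S' j) → G i S = G i S')
    (hG0 : ∀ S, S 0 = 0 → G 0 S = 0)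
    (hb : ∀ i ≤ 2 ^ n, ∀ S : ℕ → ℝ, S 0 = 0 → (∀ j ≤ i, |S j| ≤ R) → G i S ≤ 1)
    (hstep : ∀ i < 2 ^ n, ∀ S : ℕ → ℝ, S 0 = 0 → (∀ j ≤ i, |S j| ≤ R / 2) →
      2 * G i S + 2 * δ ≤ G (i + 1) (Function.update S (i + 1) (S i + ε)) +
        G (i + 1) (Function.update S (i + 1) (S i - ε)))
    (hεR : ε ≤ R / 2) (hmod : modulus κ (2 ^ n * ε ^ 2) 0 ≤ (R / 2) ^ 2)
    (hκδ : 24 * κ * (2 ^ n * ε ^ 2) ^ 2 ≤ 2 ^ n * δ / 2) :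
    ∃ S : ℕ → ℝ, S 0 = 0 ∧ (∀ j ≤ 2 ^ n, |S j| ≤ R / 2) ∧
      (∀ m ≤ n, ∀ i < 2 ^ n, (S (i + 1) - S (2 ^ (n - m) * (i / 2 ^ (n - m)))) ^ 2 ≤
        modulus κ (2 ^ n * ε ^ 2) m) ∧ 2 ^ n * δ / 2 ≤ G (2 ^ n) S := by
  have hR : 0 ≤ R / 2 := hε.trans hεR
  have main : ∀ i ≤ 2 ^ n, ∃ S : ℕ → ℝ, S 0 = 0 ∧
      ∀ j ≤ i, |S j| ≤ R / 2 ∧ j * δ + multiscale κ ε n S j ≤ G j S := by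
    intro i
    induction i with
    | zero =>
      intro _
      refine ⟨fun _ => 0, rfl, fun j hj => ?_⟩
      obtain rfl : j = 0 := Nat.le_zero.mp hj
      rw [hG0 _ rfl]
      simp [multiscale, blockSum, hR]
    | succ i ih =>
      intro hi
      obtain ⟨S, hS0, hS⟩ := ih (by omega)
      have hk : ∀ x, ∀ k ≤ i, Function.update S (i + 1) x k = S k := fun x k hk =>
        Function.update_of_ne (by omega) _ _
      have h1 := hstep i hi S hS0 fun j hj => (hS j hj).1
      have h2 := multiscale_update_add (κ := κ) (ε := ε) (n := n) S i
      have h3 := (hS i le_rfl).2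
      have good : ∀ x, |x - S i| ≤ ε → ((i + 1 : ℕ) : ℝ) * δ +
          multiscale κ ε n (Function.update S (i + 1) x) (i + 1) ≤
            G (i + 1) (Function.update S (i + 1) x) →
          ∃ S : ℕ → ℝ, S 0 = 0 ∧
            ∀ j ≤ i + 1, |S j| ≤ R / 2 ∧ j * δ + multiscale κ ε n S j ≤ G j S := by
        intro x hx hgain
        set S' := Function.update S (i + 1) x with hS'
        have hk' : ∀ k ≤ i, S' k = S k := hk x
        have hS'0 : S' 0 = 0 := (hk' 0 (Nat.zero_le i)).trans hS0
        have hS'x : S' (i + 1) = x := Function.update_self _ _ _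
        have hle : G (i + 1) S' ≤ 1 := by
          refine hb _ hi S' hS'0 fun j hj => ?_
          rcases Nat.le_succ_iff.mp hj with hj | rfl
          · rw [hk' j hj]
            linarith [(hS j hj).1]
          · rw [hS'x]
            have a1 := abs_sub_abs_le_abs_sub x (S i)
            have a2 := (hS i le_rfl).1
            linarith
        have hpos : 0 ≤ ((i + 1 : ℕ) : ℝ) * δ := by positivity
        -- At scale 0 the block is the whole walk. The penalty bound thus brings the new value back
        -- within R/2, although the step alone only guaranteed R.
        have hbd := sq_le_modulus hκ (Nat.zero_le n) S' (show i < 2 ^ n from hi) (by linarith)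
        rw [Nat.sub_zero, Nat.div_eq_of_lt hi, mul_zero, hS'0, sub_zero] at hbd
        refine ⟨S', hS'0, fun j hj => ?_⟩
        rcases Nat.le_succ_iff.mp hj with hj | rfl
        · have hc : ∀ k ≤ j, S' k = S k := fun k hkj => hk' k (hkj.trans hj)
          rw [hc j le_rfl, multiscale_congr hc, hG j _ _ hc]
          exact hS j hj
        · exact ⟨abs_le_of_sq_le_sq (hbd.trans hmod) hR, hgain⟩
      -- By `hstep` and the martingale identity, the gain inequalities for the two signs hold on
      -- average; if one fails, the other holds.
      by_cases hup : ((i + 1 : ℕ) : ℝ) * δ +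
          multiscale κ ε n (Function.update S (i + 1) (S i + ε)) (i + 1) ≤
            G (i + 1) (Function.update S (i + 1) (S i + ε))
      · exact good _ (by simp [abs_of_nonneg hε]) hup
      · refine good (S i - ε) (by simp [abs_of_nonneg hε]) ?_
        push_cast at hup ⊢
        linarith
  obtain ⟨S, hS0, hS⟩ := main (2 ^ n) le_rfl
  refine ⟨S, hS0, fun j hj => (hS j hj).1, fun m hm i hi => ?_, ?_⟩
  · refine sq_le_modulus hκ hm S hi ?_
    have h1 := (hS (i + 1) hi).2
    have h2 := hb (i + 1) hi S hS0 fun j hj => by linarith [(hS j (hj.trans hi)).1]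
    have : 0 ≤ ((i + 1 : ℕ) : ℝ) * δ := by positivity
    linarith
  · have h1 := (hS (2 ^ n) le_rfl).2
    obtain ⟨i, hi⟩ : ∃ i, 2 ^ n = i + 1 := ⟨2 ^ n - 1, by have := Nat.two_pow_pos n; omega⟩
    have h2 := multiscale_ge (ε := ε) hκ S (n := n) (i := i) (by omega)
    rw [← hi] at h2
    push_cast at h1
    linarith

/-! ### Differences of C^{1,2} functionals and the terminal time -/

theorem vDeriv_sub {T : ℝ} {f g : Functional T} (hf : ∀ t ω, VerticallyDifferentiableAt f t ω)
    (hg : ∀ t ω, VerticallyDifferentiableAt g t ω) :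
    vDeriv (fun t ω => f t ω - g t ω) = fun t ω => vDeriv f t ω - vDeriv g t ω := by
  funext t ω
  exact deriv_fun_sub (hf t ω) (hg t ω)

theorem IsContinuous.sub {T : ℝ} {f g : Functional T} (hf : IsContinuous f) (hg : IsContinuous g) :
    IsContinuous (fun t ω => f t ω - g t ω) := by
  intro t ω ε hε
  obtain ⟨a, ha, h1⟩ := hf t ω (ε / 2) (by positivity)
  obtain ⟨b, hb, h2⟩ := hg t ω (ε / 2) (by positivity)
  refine ⟨min a b, lt_min ha hb, fun t' ω' h => ?_⟩
  have e1 := h1 t' ω' (h.trans_le (min_le_left _ _))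
  have e2 := h2 t' ω' (h.trans_le (min_le_right _ _))
  rw [abs_lt] at *
  constructor <;> linarith [e1.1, e1.2, e2.1, e2.2]

theorem IsContinuousAtFixedTimes.sub {T : ℝ} {f g : Functional T}
    (hf : IsContinuousAtFixedTimes f) (hg : IsContinuousAtFixedTimes g) :
    IsContinuousAtFixedTimes (fun t ω => f t ω - g t ω) := by
  intro t ht ω ε hε
  obtain ⟨a, ha, h1⟩ := hf t ht ω (ε / 2) (by positivity)
  obtain ⟨b, hb, h2⟩ := hg t ht ω (ε / 2) (by positivity)
  refine ⟨min a b, lt_min ha hb, fun ω' h => ?_⟩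
  have e1 := h1 ω' (h.trans_le (min_le_left _ _))
  have e2 := h2 ω' (h.trans_le (min_le_right _ _))
  rw [abs_lt] at *
  constructor <;> linarith [e1.1, e1.2, e2.1, e2.2]

theorem IsLocallyBounded.sub {T : ℝ} {f g : Functional T} (hf : IsLocallyBounded f)
    (hg : IsLocallyBounded g) : IsLocallyBounded (fun t ω => f t ω - g t ω) := by
  intro t ht ω
  obtain ⟨a, ha, A, h1⟩ := hf t ht ω
  obtain ⟨b, hb, B, h2⟩ := hg t ht ω
  refine ⟨min a b, lt_min ha hb, A + B, fun t' ht' ω' h => ?_⟩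
  exact (abs_sub _ _).trans (add_le_add (h1 t' ht' ω' (h.trans_le (min_le_left _ _)))
    (h2 t' ht' ω' (h.trans_le (min_le_right _ _))))

theorem IsC12.sub {T : ℝ} {f g : Functional T} (hf : IsC12 f) (hg : IsC12 g) :
    IsC12 (fun t ω => f t ω - g t ω) where
  continuous := hf.continuous.sub hg.continuous
  horizontal := by
    obtain ⟨F, h1, h2, h3⟩ := hf.horizontal
    obtain ⟨H, k1, k2, k3⟩ := hg.horizontal
    refine ⟨fun t ω => F t ω - H t ω, fun t ht ω => ?_, h2.sub k2, h3.sub k3⟩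
    refine ((h1 t ht ω).sub (k1 t ht ω)).congr fun u => ?_
    rw [← sub_div]
    congr 1
    ring
  vertical t ω := (hf.vertical t ω).fun_sub (hg.vertical t ω)
  vertical_continuous := by
    rw [vDeriv_sub hf.vertical hg.vertical]
    exact hf.vertical_continuous.sub hg.vertical_continuous
  vertical_two := by
    rw [vDeriv_sub hf.vertical hg.vertical]
    exact fun t ω => (hf.vertical_two t ω).fun_sub (hg.vertical_two t ω)
  vertical_two_continuous := by
    rw [vDeriv_sub hf.vertical hg.vertical, vDeriv_sub hf.vertical_two hg.vertical_two]
    exact hf.vertical_two_continuous.sub hg.vertical_two_continuous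

/-- Along a continuous path, s ↦ (s, ω) is continuous for d_∞, so the value at `T` is a limit from
the left. -/
theorem IsContinuous.nonpos_of_lt {T : ℝ} (hT : 0 < T) {g : Functional T} (hg : IsContinuous g)
    {ω : Path T} (hω : Continuous ω.val) (h : ∀ t : Icc (0 : ℝ) T, (t : ℝ) < T → g t ω ≤ 0)
    (t : Icc (0 : ℝ) T) : g t ω ≤ 0 := by
  rcases lt_or_ge (t : ℝ) T with ht | ht
  · exact h t ht
  by_contra! hpos
  obtain ⟨δ, hδ, hc⟩ := hg t ω (g t ω) hpos
  obtain ⟨θ, hθ, hu⟩ := Metric.uniformContinuous_iff.mp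
    (CompactSpace.uniformContinuous_of_continuous hω) (δ / 2) (by positivity)
  have htT : (t : ℝ) = T := le_antisymm t.2.2 ht
  have hm : 0 < min θ (δ / 2) / 2 := by positivity
  have hm1 := min_le_left θ (δ / 2)
  have hm2 := min_le_right θ (δ / 2)
  let v : Icc (0 : ℝ) T := ⟨max 0 (T - min θ (δ / 2) / 2), le_max_left _ _,
    max_le hT.le (by linarith)⟩
  have hvT : (v : ℝ) < T := max_lt hT (by linarith)
  have hv : |(t : ℝ) - v| ≤ min θ (δ / 2) / 2 := by
    rw [htT, abs_of_nonneg (by linarith)]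
    have : T - min θ (δ / 2) / 2 ≤ v := le_max_right _ _
    linarith
  have hd : dInf t ω v ω < δ := by
    refine lt_of_le_of_lt (dInf_le hv (b := δ / 2) fun s => ?_) (by linarith)
    rw [← Real.dist_eq]
    refine (hu (lt_of_le_of_lt (b := |(t : ℝ) - v|) ?_ (by linarith))).le
    rw [Subtype.dist_eq, Real.dist_eq]
    have := abs_min_sub_min_le_max (t : ℝ) s v s
    simpa using this
  have h1 := hc v ω hd
  have h2 := h v hvT
  rw [abs_lt] at h1
  linarith [h1.1]

/-! ### One grid step -/

/-- Every partial jump is again a staircase, so the local derivative bounds hold all along the jump.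
-/
theorem stair_bump {T : ℝ} (t : Icc (0 : ℝ) T) (δ : ℝ) (ω : Path T) (S : ℕ → ℝ) (i : ℕ) (h : ℝ) :
    (stair t δ ω S i).bump (gridTime t δ i) h =
      stair t δ ω (Function.update S (i + 1) (S i + h)) (i + 1) := by
  have hk : ∀ k ≤ i, Function.update S (i + 1) (S i + h) k = S k := fun k hk =>
    Function.update_of_ne (by omega) _ _
  simp only [stair]
  rw [stair_congr hk, Function.update_self, hk i le_rfl, add_sub_cancel_left]

theorem stair_flow {T : ℝ} {f F : Functional T} (hf : IsContinuous f)
    (hF : ∀ t : Icc (0 : ℝ) T, (t : ℝ) < T → ∀ ω : Path T, HasHorizontalDeriv f t ω (F t ω))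
    {t : Icc (0 : ℝ) T} {ω : Path T} {δ r R η C : ℝ} (hδ : 0 < δ)
    (hC : ∀ t' : Icc (0 : ℝ) T, (t' : ℝ) < T → ∀ ω', dInf t ω t' ω' < r → -C ≤ F t' ω')
    (hr : η + R < r) (hη : t + η ≤ T) {S : ℕ → ℝ} (hS : S 0 = 0) {i : ℕ}
    (hi : ((i + 1 : ℕ) : ℝ) * δ ≤ η) (hR : ∀ j ≤ i + 1, |S j| ≤ R) :
    f (gridTime t δ i) (stair t δ ω S (i + 1)) - C * δ ≤
      f (gridTime t δ (i + 1)) (stair t δ ω S (i + 1)) := by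
  have hi1 : (t : ℝ) + (i + 1 : ℕ) * δ ≤ T := by linarith
  have hi0 : (t : ℝ) + i * δ ≤ T := by
    push_cast at hi1
    linarith
  have e0 := coe_gridTime hδ hi0
  have e1 := coe_gridTime hδ hi1
  have hle : gridTime t δ i ≤ gridTime t δ (i + 1) := by
    rw [← Subtype.coe_le_coe, e0, e1]
    push_cast
    linarith
  have key := sub_le_of_horizontal hf hF hle (γ := stair t δ ω S (i + 1)) (C := C)
    (fun v hv => stair_succ_stopped hδ ω hS hi1 hv) fun v hv hv' => by
      have hv1 : (v : ℝ) < gridTime t δ (i + 1) := hv'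
      have hv0 : (gridTime t δ i : ℝ) ≤ v := hv
      rw [e0] at hv0
      have : (0 : ℝ) ≤ i * δ := by positivity
      refine hC v (hv1.trans_le (gridTime t δ (i + 1)).2.2) _ (lt_of_le_of_lt ?_ hr)
      refine dInf_stair_le hδ ω hS hi1 hR ?_ ?_
      · rw [← Subtype.coe_le_coe]
        linarith
      · rw [e1] at hv1
        linarith
  rw [e0, e1] at key
  push_cast at key
  convert key using 2
  ring

theorem continuous_stopped {T : ℝ} (t : Icc (0 : ℝ) T) {ω : Path T} (hω : Continuous ω.val) :
    Continuous (ω.stopped t).val :=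
  hω.comp (continuous_const.min continuous_id)

theorem gridTime_dInf_stair_lt {T : ℝ} {t : Icc (0 : ℝ) T} {ω : Path T} {δ r R η : ℝ} (hδ : 0 < δ)
    (hr : η + R < r) (hη : t + η ≤ T) {S : ℕ → ℝ} (hS : S 0 = 0) {i k : ℕ}
    (hk : (k : ℝ) * δ ≤ η) (hi : (i : ℝ) * δ ≤ η) (hR : ∀ j ≤ i, |S j| ≤ R) :
    dInf t ω (gridTime t δ k) (stair t δ ω S i) < r := by
  have e := coe_gridTime (t := t) hδ (i := k) (by linarith)
  have : (0 : ℝ) ≤ k * δ := by positivity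
  refine lt_of_le_of_lt (dInf_stair_le hδ ω hS (by linarith) hR ?_ ?_) hr
  · rw [← Subtype.coe_le_coe, e]
    linarith
  · rw [e]
    linarith

theorem grid_le {η : ℝ} (hη : 0 < η) {n i : ℕ} (hi : i ≤ 2 ^ n) : (i : ℝ) * (η / 2 ^ n) ≤ η := by
  have : (i : ℝ) ≤ 2 ^ n := by exact_mod_cast hi
  rw [mul_div_assoc', div_le_iff₀ (by positivity), mul_comm]
  gcongr

/-! ### First vertical derivative -/

theorem vDeriv_nonpos_of_lt {T : ℝ} {f : Functional T} (hf : IsC12 f)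
    (h0 : ∀ t (ω : Path T), Continuous ω.val → f t ω = 0) {t : Icc (0 : ℝ) T} (ht : (t : ℝ) < T)
    {ω : Path T} (hω : Continuous ω.val) : vDeriv f t ω ≤ 0 := by
  by_contra! hpos
  obtain ⟨F, hF, -, hFb⟩ := hf.horizontal
  obtain ⟨r₁, hr₁, C, hC⟩ := hFb t ht ω
  set c := vDeriv f t ω / 2 with hc
  have hc0 : 0 < c := by positivity
  obtain ⟨r₂, hr₂, hV⟩ := hf.vertical_continuous t ω c hc0
  -- A jump Kδ gains at least cKδ = (|C| + 1)δ: the horizontal loss, plus δ.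
  set K := (|C| + 1) / c with hK
  have hK0 : 0 < K := by positivity
  have hcK : c * K = |C| + 1 := by
    rw [hK]
    field_simp
  set r := min r₁ r₂ with hr
  have hr0 : 0 < r := lt_min hr₁ hr₂
  set η := min (T - t) (r / (2 * (1 + K))) with hη
  have hη0 : 0 < η := lt_min (by linarith) (by positivity)
  have hηT : t + η ≤ T := by linarith [min_le_left (T - t) (r / (2 * (1 + K)))]
  have hηr : η + K * η < r := by
    have h1 : η * (2 * (1 + K)) ≤ r := by
      rw [← le_div_iff₀ (by positivity)]
      exact min_le_right _ _
    have : 0 < η * (1 + K) := by positivity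
    linarith
  refine not_eventually_le_stair hf.continuous h0 hω hη0 hηT
    (fun n i => K * (i * (η / 2 ^ n))) (R := K * η) hη0 (by simp) ?_ ?_ ?_
  · refine Eventually.of_forall fun n i hi => ?_
    rw [abs_of_nonneg (by positivity)]
    gcongr
    exact grid_le hη0 hi
  · intro ρ hρ
    refine ⟨ρ / (K * η), by positivity, Eventually.of_forall fun n i j _ hij h => ?_⟩
    have hij' : (i : ℝ) ≤ j := by exact_mod_cast hij
    rw [← mul_sub, ← sub_mul, abs_of_nonneg (by
      have := sub_nonneg.mpr hij'
      positivity)]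
    calc K * ((j - i) * (η / 2 ^ n)) ≤ K * ((ρ / (K * η) * 2 ^ n) * (η / 2 ^ n)) := by
          gcongr
          linarith
      _ = ρ := by field_simp
  · refine Eventually.of_forall fun n => ?_
    set δ := η / 2 ^ n with hδ
    have hδ0 : 0 < δ := by positivity
    set S : ℕ → ℝ := fun i => K * (i * δ) with hS
    have hS0 : S 0 = 0 := by simp [hS]
    have hSs : ∀ i, S (i + 1) = S i + K * δ := fun i => by
      simp only [hS]
      push_cast
      ring
    have main : ∀ i ≤ 2 ^ n, i * δ ≤ f (gridTime t δ i) (stair t δ ω S i) := by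
      intro i
      induction i with
      | zero =>
        intro _
        rw [stair, h0 _ _ (continuous_stopped t hω)]
        simp
      | succ i ih =>
        intro hi
        have hiη := grid_le hη0 hi
        rw [← hδ] at hiη
        have hiη' : (i : ℝ) * δ ≤ η := by
          push_cast at hiη
          linarith
        have hSR : ∀ j ≤ i + 1, |S j| ≤ K * η := fun j hj => by
          simp only [hS]
          rw [abs_of_nonneg (by positivity)]
          gcongr
          exact grid_le hη0 (hj.trans hi)
        have h1 := ih (by omega)
        have h2 := stair_flow hf.continuous hF hδ0 (r := r) (C := |C|)
          (fun t' ht' ω' h => by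
            have := hC t' ht' ω' (h.trans_le (min_le_left _ _))
            linarith [neg_abs_le (F t' ω'), le_abs_self C]) hηr hηT hS0 hiη hSR
        have h3 := add_mul_le_of_deriv_ge (ε := K * δ) (c := c) (by positivity)
          (hasDerivAt_bump hf.vertical (gridTime t δ i) (stair t δ ω S i)) fun h hh => by
            rw [stair_bump]
            have := hV (gridTime t δ i)
              (stair t δ ω (Function.update S (i + 1) (S i + h)) (i + 1))
              ((gridTime_dInf_stair_lt hδ0 hηr hηT ?_ hiη' hiη ?_).trans_le (min_le_right _ _))
            · rw [abs_lt] at this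
              linarith [this.1]
            · rw [Function.update_of_ne (by omega), hS0]
            · intro j hj
              rcases Nat.le_succ_iff.mp hj with hj | rfl
              · rw [Function.update_of_ne (by omega)]
                exact hSR j (by omega)
              · rw [Function.update_self]
                have a1 := hSR (i + 1) le_rfl
                rw [hSs] at a1
                have a2 : 0 ≤ S i := by positivity
                rw [abs_of_nonneg (by linarith [hh.1, mul_pos hK0 hδ0])] at a1
                rw [abs_of_nonneg (by linarith [hh.1])]
                linarith [hh.2]
        have h4 : (stair t δ ω S i).bump (gridTime t δ i) (K * δ) = stair t δ ω S (i + 1) := by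
          simp only [stair]
          rw [hSs, add_sub_cancel_left]
        rw [h4, Path.bump_zero, ← mul_assoc, hcK] at h3
        push_cast
        linarith
    have := main (2 ^ n) le_rfl
    rw [hδ] at this
    push_cast at this
    rw [mul_div_cancel₀ _ (by positivity)] at this
    exact this

/-! ### Second vertical derivative -/

/-- Indices at most `L` apart lie in the same or in adjacent blocks; chain through at most two block
starts. -/
theorem abs_sub_le_of_blocks {S : ℕ → ℝ} {L N : ℕ} {a : ℝ} (hL : 0 < L) (ha : 0 ≤ a)
    (h : ∀ i < N, |S (i + 1) - S (L * (i / L))| ≤ a) {i j : ℕ} (hij : i ≤ j) (hj : j ≤ N)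
    (hjL : j ≤ i + L) : |S j - S i| ≤ 3 * a := by
  rcases hij.eq_or_lt with rfl | hlt
  · simpa using ha
  obtain ⟨k, rfl⟩ : ∃ k, j = k + 1 := ⟨j - 1, by omega⟩
  have h1 := h k (by omega)
  have h2 : |S i - S (L * (i / L))| ≤ a := by
    rcases Nat.eq_zero_or_pos (i % L) with h0 | h0
    · rw [Nat.mul_div_cancel' (Nat.dvd_of_mod_eq_zero h0)]
      simpa using ha
    · have hm := Nat.mod_add_div i L
      have hlt := Nat.mod_lt i hL
      obtain ⟨l, rfl⟩ : ∃ l, i = l + 1 := ⟨i - 1, by have := Nat.mod_le i L; omega⟩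
      obtain ⟨e1, -⟩ := (Nat.div_mod_unique hL (a := l) (d := (l + 1) / L)
        (c := (l + 1) % L - 1)).mpr ⟨by omega, by omega⟩
      have := h l (by omega)
      rwa [e1] at this
  have hm := Nat.mod_add_div i L
  have hlt := Nat.mod_lt i hL
  have hk1 : i / L ≤ k / L := Nat.div_le_div_right (by omega)
  have hk2 : k / L ≤ i / L + 1 := by
    rw [← Nat.add_div_right i hL]
    exact Nat.div_le_div_right (by omega)
  rw [abs_le] at *
  rcases hk1.eq_or_lt with e | e
  · rw [← e] at h1
    constructor <;> linarith [h1.1, h1.2, h2.1, h2.2]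
  · have e' : k / L = i / L + 1 := by omega
    have hkm := Nat.mul_div_le k L
    have hpos : 0 < L * (k / L) := Nat.mul_pos hL (e' ▸ Nat.succ_pos _)
    rw [e'] at h1 hkm hpos
    -- The start of the next block is also the endpoint of the block of `i`, so the hypothesis at
    -- its predecessor compares the two starts.
    have hx : L * (i / L + 1) - 1 + 1 = L * (i / L + 1) := by omega
    obtain ⟨e1, -⟩ := (Nat.div_mod_unique hL (a := L * (i / L + 1) - 1) (d := i / L)
      (c := L - 1)).mpr ⟨by rw [mul_add, mul_one]; omega, by omega⟩
    have h3 := h (L * (i / L + 1) - 1) (by omega)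
    rw [hx, e1, abs_le] at h3
    constructor <;> linarith [h1.1, h1.2, h2.1, h2.2, h3.1, h3.2]

theorem tendsto_modulus (κ V : ℝ) : Tendsto (modulus κ V) atTop (𝓝 0) := by
  have h1 : Tendsto (fun m : ℕ => V / 2 ^ m) atTop (𝓝 0) :=
    tendsto_const_nhds.div_atTop (tendsto_pow_atTop_atTop_of_one_lt one_lt_two)
  have h2 : Tendsto (fun m : ℕ => (1 / κ + 24 * V ^ 2) / (3 / 2) ^ m) atTop (𝓝 0) :=
    tendsto_const_nhds.div_atTop (tendsto_pow_atTop_atTop_of_one_lt (by norm_num))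
  have h3 := (h1.const_mul 3).add h2.sqrt
  rw [mul_zero, Real.sqrt_zero, add_zero] at h3
  exact h3

theorem vDeriv_two_nonpos_of_lt {T : ℝ} {f : Functional T} (hf : IsC12 f)
    (h0 : ∀ t (ω : Path T), Continuous ω.val → f t ω = 0) {t : Icc (0 : ℝ) T} (ht : (t : ℝ) < T)
    {ω : Path T} (hω : Continuous ω.val) : vDeriv (vDeriv f) t ω ≤ 0 := by
  by_contra! hpos
  obtain ⟨F, hF, -, hFb⟩ := hf.horizontal
  obtain ⟨r₁, hr₁, C, hC⟩ := hFb t ht ω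
  set c := vDeriv (vDeriv f) t ω / 2 with hc
  have hc0 : 0 < c := by positivity
  obtain ⟨r₂, hr₂, hV⟩ := hf.vertical_two_continuous t ω c hc0
  obtain ⟨r₃, hr₃, hf1⟩ := hf.continuous t ω 1 one_pos
  -- The mean gain cε²/2 = cKδ/2 is (|C| + 1)δ.
  set K := 2 * (|C| + 1) / c with hK
  have hK0 : 0 < K := by positivity
  have hcK : c * K = 2 * (|C| + 1) := by
    rw [hK]
    field_simp
  set r := min r₁ (min r₂ r₃) with hr
  have hr0 : 0 < r := lt_min hr₁ (lt_min hr₂ hr₃)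
  set R := r / 2 with hR
  have hR0 : 0 < R := by positivity
  set b := R ^ 2 / 8 with hb
  have hb0 : 0 < b := by positivity
  set κ := 2 / b ^ 2 with hκ
  have hκ0 : 0 < κ := by positivity
  -- As 1/κ = b²/2 and 24/49 < 1/2, the bound Kη ≤ b/7 makes the root in `modulus` at most b, and
  -- 3b/7 + b ≤ 2b = (R/2)². The last condition lets half of the gain η survive the penalty.
  obtain ⟨η, hη0, hηT, hηr, hηb, hηκ⟩ : ∃ η > 0, t + η ≤ T ∧ η + R < r ∧ K * η ≤ b / 7 ∧
      24 * κ * (K * η) ^ 2 ≤ η / 2 := by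
    refine ⟨min (min (T - t) (r / 4)) (min (b / 7 / K) (1 / (48 * κ * K ^ 2))),
      lt_min (lt_min (by linarith) (by positivity)) (lt_min (by positivity) (by positivity)), ?_⟩
    set η := min (min (T - t) (r / 4)) (min (b / 7 / K) (1 / (48 * κ * K ^ 2)))
    have hη0 : 0 < η :=
      lt_min (lt_min (by linarith) (by positivity)) (lt_min (by positivity) (by positivity))
    have h1 : η ≤ T - t := (min_le_left _ _).trans (min_le_left _ _)
    have h2 : η ≤ r / 4 := (min_le_left _ _).trans (min_le_right _ _)
    have h3 : η ≤ b / 7 / K := (min_le_right _ _).trans (min_le_left _ _)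
    have h4 : η ≤ 1 / (48 * κ * K ^ 2) := (min_le_right _ _).trans (min_le_right _ _)
    rw [le_div_iff₀ hK0] at h3
    rw [le_div_iff₀ (by positivity)] at h4
    refine ⟨by linarith, by linarith, by linarith, ?_⟩
    have := mul_le_mul_of_nonneg_left h4 hη0.le
    nlinarith
  have hmod : modulus κ (K * η) 0 ≤ (R / 2) ^ 2 := by
    have h1 : √((1 / κ + 24 * (K * η) ^ 2) / (3 / 2) ^ 0) ≤ b := by
      refine Real.sqrt_le_iff.mpr ⟨hb0.le, ?_⟩
      have e1 : 1 / κ = b ^ 2 / 2 := by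
        rw [hκ]
        field_simp
      have e2 : (K * η) ^ 2 ≤ (b / 7) ^ 2 := by gcongr
      rw [e1, pow_zero, div_one]
      nlinarith
    unfold modulus
    rw [pow_zero, div_one]
    have : (R / 2) ^ 2 = 2 * b := by
      rw [hb]
      ring
    linarith
  have hlocF : ∀ t' : Icc (0 : ℝ) T, (t' : ℝ) < T → ∀ ω', dInf t ω t' ω' < r → -|C| ≤ F t' ω' := by
    intro t' ht' ω' h
    have := hC t' ht' ω' (h.trans_le (min_le_left _ _))
    linarith [neg_abs_le (F t' ω'), le_abs_self C]
  have hlocV : ∀ t' ω', dInf t ω t' ω' < r → c ≤ vDeriv (vDeriv f) t' ω' := by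
    intro t' ω' h
    have := hV t' ω' (h.trans_le ((min_le_right _ _).trans (min_le_left _ _)))
    rw [abs_lt] at this
    linarith [this.1]
  have hlocf : ∀ t' ω', dInf t ω t' ω' < r → f t' ω' ≤ 1 := by
    intro t' ω' h
    have := hf1 t' ω' (h.trans_le ((min_le_right _ _).trans (min_le_right _ _)))
    rw [h0 t ω hω, sub_zero, abs_lt] at this
    exact this.2.le
  have walk : ∀ n : ℕ, ∃ S : ℕ → ℝ, K * η * 4 / R ^ 2 ≤ 2 ^ n →
      S 0 = 0 ∧ (∀ j ≤ 2 ^ n, |S j| ≤ R / 2) ∧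
      (∀ m ≤ n, ∀ i < 2 ^ n, (S (i + 1) - S (2 ^ (n - m) * (i / 2 ^ (n - m)))) ^ 2 ≤
        modulus κ (K * η) m) ∧
      η / 2 ≤ f (gridTime t (η / 2 ^ n) (2 ^ n)) (stair t (η / 2 ^ n) ω S (2 ^ n)) := by
    intro n
    rcases lt_or_ge ((2 : ℝ) ^ n) (K * η * 4 / R ^ 2) with hn | hn
    -- A default for coarse grids, where ε could exceed R/2; only large n matter.
    · exact ⟨0, fun h => absurd h (not_le.mpr hn)⟩
    set δ := η / 2 ^ n with hδ
    have hδ0 : 0 < δ := by positivity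
    set ε := √(K * δ) with hε
    have hε0 : 0 ≤ ε := Real.sqrt_nonneg _
    have hε2 : ε ^ 2 = K * δ := Real.sq_sqrt (by positivity)
    have hNδ : 2 ^ n * δ = η := by
      rw [hδ]
      field_simp
    have hNε : 2 ^ n * ε ^ 2 = K * η := by
      rw [hε2, ← hNδ]
      ring
    have hεR : ε ≤ R / 2 := by
      refine Real.sqrt_le_iff.mpr ⟨by positivity, ?_⟩
      rw [div_le_iff₀ (by positivity)] at hn
      rw [hδ, mul_div_assoc', div_le_iff₀ (by positivity)]
      linarith
    have hgrid : ∀ i : ℕ, i ≤ 2 ^ n → (i : ℝ) * δ ≤ η := fun i hi => by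
      rw [hδ]
      exact grid_le hη0 hi
    have key := exists_equicontinuous_walk (κ := κ) (ε := ε) (δ := δ) (R := R) (n := n)
      (G := fun i S => f (gridTime t δ i) (stair t δ ω S i)) hκ0 hε0 hδ0.le
      (fun i S S' h => by simp only [stair_congr h])
      (fun S _ => h0 _ _ (continuous_stopped t hω))
      (fun i hi S hS h => hlocf _ _
        (gridTime_dInf_stair_lt hδ0 hηr hηT hS (hgrid i hi) (hgrid i hi) h)) ?_ hεR
      (by rw [hNε]; exact hmod) (by rw [hNε, hNδ]; exact hηκ)
    · obtain ⟨S, h1, h2, h3, h4⟩ := key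
      rw [hNδ] at h4
      rw [hNε] at h3
      exact ⟨S, fun _ => ⟨h1, h2, h3, h4⟩⟩
    · intro i hi S hS0 hSR
      have hup0 : ∀ x, Function.update S (i + 1) x 0 = 0 := fun x => by
        rw [Function.update_of_ne (by omega), hS0]
      have hupR : ∀ h, |h| ≤ ε → ∀ j ≤ i + 1, |Function.update S (i + 1) (S i + h) j| ≤ R := by
        intro h hh j hj
        rcases Nat.le_succ_iff.mp hj with hj | rfl
        · rw [Function.update_of_ne (by omega)]
          linarith [hSR j hj]
        · rw [Function.update_self]
          linarith [abs_add_le (S i) h, hSR i le_rfl]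
      have flow : ∀ h, |h| ≤ ε → _ := fun h hh =>
        stair_flow hf.continuous hF hδ0 hlocF hηr hηT (hup0 (S i + h)) (hgrid (i + 1) hi)
          (hupR h hh)
      have f1 := flow ε (abs_of_nonneg hε0).le
      have f2 := flow (-ε) (by rw [abs_neg, abs_of_nonneg hε0])
      have h2 := two_mul_add_le_of_deriv_two_ge (c := c) hε0
        (hasDerivAt_bump hf.vertical (gridTime t δ i) (stair t δ ω S i))
        (hasDerivAt_bump hf.vertical_two (gridTime t δ i) (stair t δ ω S i)) fun h hh => by
          rw [stair_bump]
          exact hlocV _ _ (gridTime_dInf_stair_lt hδ0 hηr hηT (hup0 _) (hgrid i hi.le)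
            (hgrid (i + 1) hi) (hupR h (abs_le.mpr hh)))
      rw [Path.bump_zero, stair_bump, stair_bump, hε2, ← mul_assoc, hcK] at h2
      rw [← sub_eq_add_neg] at f2 h2
      linarith
  choose S hS using walk
  have hlarge : ∀ᶠ n : ℕ in atTop, K * η * 4 / R ^ 2 ≤ (2 : ℝ) ^ n :=
    (tendsto_pow_atTop_atTop_of_one_lt one_lt_two).eventually_ge_atTop _
  refine not_eventually_le_stair hf.continuous h0 hω hη0 hηT S (R := R / 2) (half_pos hη0)
    (hlarge.mono fun n hn => (hS n hn).1) (hlarge.mono fun n hn => (hS n hn).2.1) ?_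
    (hlarge.mono fun n hn => (hS n hn).2.2.2)
  intro ρ hρ
  obtain ⟨m, hm⟩ := ((tendsto_modulus κ (K * η)).eventually_le_const
    (show (0 : ℝ) < (ρ / 3) ^ 2 by positivity)).exists
  -- A fraction 1/2^m of the grid is exactly one block of scale m.
  refine ⟨1 / 2 ^ m, by positivity, ?_⟩
  filter_upwards [hlarge, eventually_ge_atTop m] with n hn hmn i j hj hij hji
  have hjL : j ≤ i + 2 ^ (n - m) := by
    have : (2 : ℝ) ^ n = 2 ^ (n - m) * 2 ^ m := by
      rw [← pow_add]
      congr 1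
      omega
    rw [this, one_div, mul_comm _ ((2 : ℝ) ^ m), inv_mul_cancel_left₀ (by positivity)] at hji
    exact_mod_cast hji
  have := abs_sub_le_of_blocks (S := S n) (Nat.two_pow_pos (n - m)) (show 0 ≤ ρ / 3 by positivity)
    (fun i hi => abs_le_of_sq_le_sq (((hS n hn).2.2.1 m hmn i hi).trans hm) (by positivity))
    hij hj hjL
  linarith

theorem vDeriv_le_of_eq_on_continuous {T : ℝ} (hT : 0 < T) {f g : Functional T} (hf : IsC12 f)
    (hg : IsC12 g) (h : ∀ t (ω : Path T), Continuous ω.val → f t ω = g t ω) (t : Icc (0 : ℝ) T)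
    {ω : Path T} (hω : Continuous ω.val) :
    vDeriv f t ω ≤ vDeriv g t ω ∧ vDeriv (vDeriv f) t ω ≤ vDeriv (vDeriv g) t ω := by
  have hfg := hf.sub hg
  have h0 : ∀ t (ω : Path T), Continuous ω.val → f t ω - g t ω = 0 := fun t ω hω =>
    sub_eq_zero.mpr (h t ω hω)
  have h1 := hfg.vertical_continuous.nonpos_of_lt hT hω
    (fun t ht => vDeriv_nonpos_of_lt hfg h0 ht hω) t
  have h2 := hfg.vertical_two_continuous.nonpos_of_lt hT hω
    (fun t ht => vDeriv_two_nonpos_of_lt hfg h0 ht hω) t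
  rw [vDeriv_sub hf.vertical hg.vertical] at h1 h2
  rw [vDeriv_sub hf.vertical_two hg.vertical_two] at h2
  exact ⟨sub_nonpos.mp h1, sub_nonpos.mp h2⟩

end PathCalculus

end

theorem corollary2 (T : ℝ) (hT : 0 < T) (f₁ f₂ : PathCalculus.Functional T)
    (hf₁ : PathCalculus.IsC12 f₁) (hf₂ : PathCalculus.IsC12 f₂)
    (hagree : ∀ (t : Set.Icc (0 : ℝ) T) (ω : PathCalculus.Path T),
      Continuous ω.val → f₁ t ω = f₂ t ω) :
    ∀ (t : Set.Icc (0 : ℝ) T) (ω : PathCalculus.Path T), Continuous ω.val →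
      PathCalculus.vDeriv f₁ t ω = PathCalculus.vDeriv f₂ t ω ∧
        PathCalculus.vDeriv (PathCalculus.vDeriv f₁) t ω =
          PathCalculus.vDeriv (PathCalculus.vDeriv f₂) t ω := by
  intro t ω hω
  obtain ⟨h1, h2⟩ := PathCalculus.vDeriv_le_of_eq_on_continuous hT hf₁ hf₂ hagree t hω
  obtain ⟨k1, k2⟩ := PathCalculus.vDeriv_le_of_eq_on_continuous hT hf₂ hf₁
    (fun t ω hω => (hagree t ω hω).symm) t hω
  exact ⟨le_antisymm h1 k1, le_antisymm h2 k2⟩
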